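/- Let $p$ be a prime, let $k$ be a field of characteristic $p$, let $G$ be a finite $p$-group and let $H$ be a non-trivial subgroup of $G$. Let $x$ be a central element of $G$, and let $l$ be the smallest positive integer such that $x^l\in H$. For a finite group $K$, let $\mathrm{StMod}(kK)$ be the stable module category, whose objects are the left $kK$-modules and whose morphisms are the $kK$-linear maps modulo those that factor through a projective module. Let $\mathrm{stmod}(kK)$ be its full subcategory on the modules that are stably isomorphic to finitely generated ones. Let $\mathrm{thick}\langle k\rangle$ be the smallest full triangulated subcategory of $\mathrm{StMod}(kK)$ that contains the trivial module $k$ and is closed under retracts. A *ghost* is a map that induces zero in Tate cohomology $\hat H^n(K,-)$ for all $n\in\mathbb Z$. Let $\mathcal F$ be the class of retracts in $\mathrm{StMod}(kK)$ of arbitrary direct sums of modules $\Omega^i k$ ($i\in\mathbb Z$). Let $\mathcal F_0$ be the class of zero objects of $\mathrm{StMod}(kK)$, and let $\mathcal F_n$ for $n\ge 1$ be the class of retracts of objects $X$ sitting in a cofibre sequence $P\to X\to Q$ with $P\in\mathcal F$ and $Q\in\mathcal F_{n-1}$. * The generating length $\mathrm{gel}(M)$ of a $kK$-module $M$ is the smallest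 $n\ge 0$ with $M\in\mathcal F_n$. * The ghost length $\mathrm{gl}(M)$ of $M\in\mathrm{thick}\langle k\rangle$ is the smallest $n\ge 0$ such that every $n$-fold composite of ghosts in $\mathrm{thick}\langle k\rangle$ with domain $M$ is stably trivial (for $n=0$: every map in $\mathrm{thick}\langle k\rangle$ with domain $M$). * The generating number and the ghost number of $kK$ are the least upper bounds of $\mathrm{gel}(M)$ and of $\mathrm{gl}(M)$, respectively, over all $M\in\mathrm{thick}\langle k\rangle$. All these invariants take values in $\mathbb N\cup\{\infty\}$, the value $\infty$ meaning that no such $n$, or no finite bound, exists. Write $M{\uparrow}^G=kG\otimes_{kH}M$. Then: 1. for every $M\in\mathrm{StMod}(kH)$ with $\mathrm{gel}(M)\ge 1$, $$\mathrm{gel}(M{\uparrow}^G)\ \ge\ \mathrm{gel}(M)+(l-1);$$ 2. $$\text{generating number of }kG\ \ge\ \text{generating number of }kH+(l-1);$$ 3. for every $M\in\mathrm{stmod}(kH)$ with $\mathrm{gl}(M)\ge 1$, $$\mathrm{gl}(M{\uparrow}^G)\ \ge\ \mathrm{gl}(M)+(l-1);$$ 4. $$\text{ghost number of }kG\ \ge\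 \text{ghost number of }kH+(l-1).$$ -/

import Mathlib

open CategoryTheory Limits

universe u

noncomputable section

/-! Left `kG`-modules are the objects of `Rep k G`. Morphisms of the stable module category
`StMod(kG)` are represented by morphisms of `Rep k G`; two of them represent the same stable
morphism if and only if they are related by `StableRep.StablyEq`. -/

namespace StableRep

section

variable {k G : Type u} [Field k] [Group G]

/-- A map is stably trivial if it factors through a projective module. -/
def StablyTrivial {M N : Rep.{u} k G} (f : M ⟶ N) : Prop :=
  ∃ (P : Rep.{u} k G) (a : M ⟶ P) (b : P ⟶ N), Projective P ∧ a ≫ b = f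

/-- Two maps are equal in the stable module category. -/
def StablyEq {M N : Rep.{u} k G} (f g : M ⟶ N) : Prop :=
  StablyTrivial (f - g)

/-- `M` is a retract of `N` in the stable module category. -/
def StableRetract (M N : Rep.{u} k G) : Prop :=
  ∃ (i : M ⟶ N) (r : N ⟶ M), StablyEq (i ≫ r) (𝟙 M)

/-- `M` and `N` are isomorphic in the stable module category. -/
def StablyIso (M N : Rep.{u} k G) : Prop :=
  ∃ (f : M ⟶ N) (g : N ⟶ M), StablyEq (f ≫ g) (𝟙 M) ∧ StablyEq (g ≫ f) (𝟙 N)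

/-- `M` belongs to `stmod(kG)`: it is stably isomorphic to a finitely generated `kG`-module
(as `G` is finite, finitely generated over `kG` means finite-dimensional over `k`). -/
def InStmod (M : Rep.{u} k G) : Prop :=
  ∃ N : Rep.{u} k G, Module.Finite k N.V ∧ StablyIso M N

/-- `IsOmega n X` says that `X` is a model of `Ω ^ n k`, where `k` is the trivial module, `Ω Y` is
the kernel of any surjection onto `Y` from a projective module, and `Ω⁻¹ Y = Σ Y` is the cokernel
of any injection of `Y` into an injective module. -/
inductive IsOmega : ℤ → Rep.{u} k G → Prop
  | trivial : IsOmega 0 (Rep.trivial k G k)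
  | omega (n : ℤ) (S : ShortComplex (Rep.{u} k G)) (hS : S.ShortExact)
      (hP : Projective S.X₂) (h : IsOmega n S.X₃) : IsOmega (n + 1) S.X₁
  | sigma (n : ℤ) (S : ShortComplex (Rep.{u} k G)) (hS : S.ShortExact)
      (hI : Injective S.X₂) (h : IsOmega n S.X₁) : IsOmega (n - 1) S.X₃

/-- The class `F`: stable retracts of (arbitrary) direct sums of suspensions and desuspensions of
the trivial module `k`. -/
def InF (M : Rep.{u} k G) : Prop :=
  ∃ (ι : Type u) (S : ι → Rep.{u} k G),
    (∀ i, ∃ n : ℤ, IsOmega n (S i)) ∧ StableRetract M (∐ S)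

/-- The class `F_n`: `F_0` consists of the stably zero modules, that is, the projective modules;
`F_{n+1}` consists of the stable retracts of the modules `X` that sit in a cofibre sequence
`P ⟶ X ⟶ Q` with `P` in `F` and `Q` in `F_n`. The cofibre sequences of the stable module category
are, up to stable isomorphism, the short exact sequences of modules. -/
def InFn : ℕ → Rep.{u} k G → Prop
  | 0, M => Projective M
  | n + 1, M => ∃ S : ShortComplex (Rep.{u} k G),
      S.ShortExact ∧ InF S.X₁ ∧ InFn n S.X₃ ∧ StableRetract M S.X₂

/-- The generating length of `M`: the least `n` with `M` in `F_n` (`⊤` if there is none). -/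
def gel (M : Rep.{u} k G) : ℕ∞ :=
  sInf ((fun n : ℕ => (n : ℕ∞)) '' {n : ℕ | InFn n M})

/-- The thick subcategory of the stable module category generated by the trivial module `k`:
the smallest class of modules that contains `k`, is closed under stable retracts (in particular
under stable isomorphism) and has the two-out-of-three property for cofibre sequences. It is closed
under `Ω` and `Ω⁻¹`, because projective modules are retracts of every module. -/
inductive InThick : Rep.{u} k G → Prop
  | trivial : InThick (Rep.trivial k G k)
  | retract (M N : Rep.{u} k G) (h : StableRetract M N) (hN : InThick N) : InThick M
  | left (S : ShortComplex (Rep.{u} k G)) (hS : S.ShortExact)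
      (h₂ : InThick S.X₂) (h₃ : InThick S.X₃) : InThick S.X₁
  | middle (S : ShortComplex (Rep.{u} k G)) (hS : S.ShortExact)
      (h₁ : InThick S.X₁) (h₃ : InThick S.X₃) : InThick S.X₂
  | right (S : ShortComplex (Rep.{u} k G)) (hS : S.ShortExact)
      (h₁ : InThick S.X₁) (h₂ : InThick S.X₂) : InThick S.X₃

/-- A ghost: a map that induces zero in Tate cohomology in every degree. -/
def IsGhost [Fintype G] {M N : Rep.{u} k G} (f : M ⟶ N) : Prop :=
  ∀ n : ℤ, (tateCohomologyFunctor n).map f = 0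

/-- `InGt n f` says that `f` lies in the power `(G_t)^n` of the ideal `G_t` of ghosts between
modules of the thick subcategory generated by `k`: stably, `f` is a composite of `n` such ghosts,
all intermediate modules lying in the thick subcategory as well. For `n = 0` every map of the
thick subcategory is allowed. -/
def InGt [Fintype G] : ℕ → ∀ {M N : Rep.{u} k G}, (M ⟶ N) → Prop
  | 0, M, N, _ => InThick M ∧ InThick N
  | n + 1, M, N, f => InThick N ∧ ∃ (Y : Rep.{u} k G) (g : M ⟶ Y) (h : Y ⟶ N),
      InGt n g ∧ IsGhost h ∧ StablyEq f (g ≫ h)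

/-- The ghost length of a module `M` of the thick subcategory generated by `k`: the least `n` such
that every map in `(G_t)^n` with domain `M` is stably trivial (`⊤` if there is none). -/
def gl [Fintype G] (M : Rep.{u} k G) : ℕ∞ :=
  sInf ((fun n : ℕ => (n : ℕ∞)) ''
    {n : ℕ | ∀ (N : Rep.{u} k G) (f : M ⟶ N), InGt n f → StablyTrivial f})

end

/-- The generating number of `kG`. -/
def generatingNumber (k G : Type u) [Field k] [Group G] : ℕ∞ :=
  ⨆ M : {M : Rep.{u} k G // InThick M}, gel M.1

/-- The ghost number of `kG`. -/
def ghostNumber (k G : Type u) [Field k] [Group G] [Fintype G] : ℕ∞ :=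
  ⨆ M : {M : Rep.{u} k G // InThick M}, gl M.1

end StableRep

end

/-! Ghosts bound both lengths from below. The class `InFn n` consists of the modules out of which
every `n`-fold composite of ghosts is stably trivial (`inFn_iff`: the ghost lemma, with universal
ghosts for the converse), so `gel` and `gl` are both measured by composites of ghosts.

Take an `n`-fold composite `f : M ⟶ N` over `H` that is not stably trivial. Its induction is again
such a composite (`IsGhost.induce`), because induction is also right adjoint to restriction and `Ω^i
k` restricts to `Ω^i k`. Since `x` is central, `x - 1` is a natural endomorphism; it kills `k`,
hence is stably trivial on every `Ω^i k`, and so is a ghost (`isGhost_centralSub`). Put `(x -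
1)^(l-1)` in front of the induced map. Between the unit `M ⟶ M↑G` and the counit `N↑G ⟶ N` only its
constant term survives, as `x, ..., x^(l-1)` lie outside `H`; the result is `(-1)^(l-1) f`
(`stablyTrivial_of_centralSubPow_comp`). So the composite of `n + (l-1)` ghosts is not stably
trivial.

For the suprema, induction must preserve thick modules (`inThick_of_finite`, from the `p`-group
hypothesis) and some length over `H` must be positive (`not_projective_trivial`, from `H ≠ ⊥`). -/

noncomputable section

namespace StableRep

/-! ### Averaging over the group: projective, injective and stably trivial. -/

section Averaging

variable {k G : Type u} [Field k] [Group G]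

/-- The functions `G → M` with `G` acting by right translation. -/
def functions (M : Rep.{u} k G) : Rep.{u} k G :=
  Rep.of (X := G → M.V)
    { toFun := fun g => LinearMap.funLeft k M.V (· * g)
      map_one' := by ext; simp [LinearMap.funLeft]
      map_mul' := fun a b => by ext; simp [LinearMap.funLeft, mul_assoc] }

/-- The value of a function at `g`. -/
def functionsEval (M : Rep.{u} k G) (g : G) : (functions M).V →ₗ[k] M.V :=
  LinearMap.proj (R := k) (φ := fun _ : G => M.V) g

/-- The function supported at `1` with a given value. -/
def functionsSingle (M : Rep.{u} k G) : M.V →ₗ[k] (functions M).V := by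
  classical exact LinearMap.single k (fun _ : G => M.V) 1

lemma functions_ext {M : Rep.{u} k G} {a b : (functions M).V}
    (h : ∀ g, functionsEval M g a = functionsEval M g b) : a = b := funext h

lemma functionsEval_ρ (M : Rep.{u} k G) (g h : G) (f : (functions M).V) :
    functionsEval M h ((functions M).ρ g f) = functionsEval M (h * g) f := rfl

open scoped Classical in
lemma functionsEval_single (M : Rep.{u} k G) (g : G) (m : M.V) :
    functionsEval M g (functionsSingle M m) = if g = 1 then m else 0 := by
  change (Pi.single 1 m : G → M.V) g = _
  rw [Pi.single_apply]

variable [Fintype G]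

/-- The `G`-equivariant map `∑ g, g φ g⁻¹` attached to a `k`-linear map `φ`. -/
def average {M N : Rep.{u} k G} (φ : M.V →ₗ[k] N.V) : M ⟶ N :=
  Rep.ofHom (ρ := M.ρ) (σ := N.ρ) ⟨∑ g : G, N.ρ g ∘ₗ φ ∘ₗ M.ρ g⁻¹, fun h => by
    ext m
    simp only [LinearMap.comp_apply, LinearMap.sum_apply, map_sum]
    refine Fintype.sum_equiv (Equiv.mulLeft h⁻¹) _ _ fun g => ?_
    simp only [Equiv.coe_mulLeft, mul_inv_rev, inv_inv, map_mul, Module.End.mul_apply,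
      Representation.self_inv_apply]⟩

lemma average_apply {M N : Rep.{u} k G} (φ : M.V →ₗ[k] N.V) (m : M.V) :
    (average φ).hom m = ∑ g : G, N.ρ g (φ (M.ρ g⁻¹ m)) := by
  change (∑ g : G, N.ρ g ∘ₗ φ ∘ₗ M.ρ g⁻¹) m = _
  simp

lemma average_comp {M N L : Rep.{u} k G} (φ : M.V →ₗ[k] N.V) (f : N ⟶ L) :
    average φ ≫ f = average (M := M) (N := L) (f.hom.toLinearMap ∘ₗ φ) := by
  ext m
  simp [average_apply, Rep.hom_comm_apply]

lemma comp_average {M N L : Rep.{u} k G} (f : M ⟶ N) (φ : N.V →ₗ[k] L.V) :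
    f ≫ average φ = average (M := M) (N := L) (φ ∘ₗ f.hom.toLinearMap) := by
  ext m
  simp [average_apply, Rep.hom_comm_apply]

/-- Higman's criterion: choose a `k`-linear section, precompose it with `θ` and average. -/
lemma projective_of_average {M : Rep.{u} k G} (θ : M.V →ₗ[k] M.V)
    (hθ : average (M := M) (N := M) θ = 𝟙 M) : Projective M where
  factors {E X} f e he := by
    obtain ⟨s, hs⟩ := e.hom.toLinearMap.exists_rightInverse_of_surjective
      (LinearMap.range_eq_top.2 ((Rep.epi_iff_surjective e).1 he))
    refine ⟨average (M := M) (N := E) (s ∘ₗ f.hom.toLinearMap ∘ₗ θ), ?_⟩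
    rw [average_comp, ← LinearMap.comp_assoc, ← LinearMap.comp_assoc, hs, LinearMap.id_comp,
      ← average_comp, hθ, Category.id_comp]

lemma injective_of_average {M : Rep.{u} k G} (θ : M.V →ₗ[k] M.V)
    (hθ : average (M := M) (N := M) θ = 𝟙 M) : Injective M where
  factors {X Y} f e he := by
    obtain ⟨s, hs⟩ := e.hom.toLinearMap.exists_leftInverse_of_injective
      (LinearMap.ker_eq_bot.2 ((Rep.mono_iff_injective e).1 he))
    refine ⟨average (M := Y) (N := M) (θ ∘ₗ f.hom.toLinearMap ∘ₗ s), ?_⟩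
    rw [comp_average, LinearMap.comp_assoc, LinearMap.comp_assoc, hs, LinearMap.comp_id,
      ← comp_average, hθ, Category.comp_id]

/-- The projection onto functions supported at `1` has translates projecting onto the single points
of `G`; these add up to the identity. -/
lemma exists_average_functions (M : Rep.{u} k G) :
    ∃ θ : (functions M).V →ₗ[k] (functions M).V,
      average (M := functions M) (N := functions M) θ = 𝟙 _ := by
  classical
  refine ⟨functionsSingle M ∘ₗ functionsEval M 1, ?_⟩
  ext f
  refine functions_ext fun h => ?_
  change functionsEval M h ((average _).hom f) = functionsEval M h f
  rw [average_apply]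
  simp [map_sum, functionsEval_ρ, functionsEval_single, mul_eq_one_iff_eq_inv']

/-- The inclusion of `M` into the functions `G → M`. -/
def toFunctions (M : Rep.{u} k G) : M ⟶ functions M :=
  Rep.ofHom (ρ := M.ρ) (σ := (functions M).ρ)
    ⟨(LinearMap.pi fun g => M.ρ g : M.V →ₗ[k] G → M.V), fun g => by
    ext m
    refine functions_ext fun h => ?_
    change M.ρ h (M.ρ g m) = M.ρ (h * g) m
    simp⟩

omit [Fintype G] in
lemma functionsEval_toFunctions (M : Rep.{u} k G) (g : G) (m : M.V) :
    functionsEval M g ((toFunctions M).hom m) = M.ρ g m := rfl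

/-- The projection of the functions `G → M` onto `M`. -/
def ofFunctions (M : Rep.{u} k G) : functions M ⟶ M :=
  Rep.ofHom (ρ := (functions M).ρ) (σ := M.ρ)
    ⟨∑ g : G, M.ρ g⁻¹ ∘ₗ functionsEval M g, fun g => by
    ext f
    simp only [LinearMap.comp_apply, LinearMap.sum_apply, functionsEval_ρ, map_sum]
    refine Fintype.sum_equiv (Equiv.mulRight g) _ _ fun h => ?_
    simp⟩

lemma ofFunctions_apply (M : Rep.{u} k G) (f : (functions M).V) :
    (ofFunctions M).hom f = ∑ g : G, M.ρ g⁻¹ (functionsEval M g f) := by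
  change (∑ g : G, M.ρ g⁻¹ ∘ₗ functionsEval M g) f = _
  simp

instance (M : Rep.{u} k G) : Mono (toFunctions M) := by
  rw [Rep.mono_iff_injective]
  intro a b h
  simpa [functionsEval_toFunctions] using congrArg (functionsEval M 1) h

instance (M : Rep.{u} k G) : Epi (ofFunctions M) := by
  classical
  rw [Rep.epi_iff_surjective]
  intro m
  exact ⟨functionsSingle M m, by
    simp [ofFunctions_apply, functionsEval_single, apply_ite]⟩

instance instProjectiveFunctions (M : Rep.{u} k G) : Projective (functions M) :=
  projective_of_average _ (exists_average_functions M).choose_spec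

instance (M : Rep.{u} k G) : Injective (functions M) :=
  injective_of_average _ (exists_average_functions M).choose_spec

lemma exists_average_of_retract {M P : Rep.{u} k G} (i : M ⟶ P) (r : P ⟶ M) (h : i ≫ r = 𝟙 M)
    (hP : ∃ θ : P.V →ₗ[k] P.V, average (M := P) (N := P) θ = 𝟙 _) :
    ∃ θ : M.V →ₗ[k] M.V, average (M := M) (N := M) θ = 𝟙 _ := by
  obtain ⟨θ, hθ⟩ := hP
  refine ⟨r.hom.toLinearMap ∘ₗ θ ∘ₗ i.hom.toLinearMap, ?_⟩
  rw [← average_comp (M := M) (N := P), ← comp_average (M := M) (N := P), hθ, Category.comp_id, h]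

lemma exists_average_of_projective (M : Rep.{u} k G) [Projective M] :
    ∃ θ : M.V →ₗ[k] M.V, average (M := M) (N := M) θ = 𝟙 _ :=
  exists_average_of_retract (Projective.factorThru (𝟙 M) (ofFunctions M)) (ofFunctions M)
    (by simp) (exists_average_functions M)

lemma exists_average_of_injective (M : Rep.{u} k G) [Injective M] :
    ∃ θ : M.V →ₗ[k] M.V, average (M := M) (N := M) θ = 𝟙 _ :=
  exists_average_of_retract (toFunctions M) (Injective.factorThru (𝟙 M) (toFunctions M))
    (by simp) (exists_average_functions M)

/-- Both say that the identity is an average, which makes no use of finite dimension. -/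
lemma projective_iff_injective (M : Rep.{u} k G) : Projective M ↔ Injective M :=
  ⟨fun _ => injective_of_average _ (exists_average_of_projective M).choose_spec,
    fun _ => projective_of_average _ (exists_average_of_injective M).choose_spec⟩

lemma stablyTrivial_iff_exists_average {M N : Rep.{u} k G} (f : M ⟶ N) :
    StablyTrivial f ↔ ∃ φ : M.V →ₗ[k] N.V, average (M := M) (N := N) φ = f := by
  constructor
  · rintro ⟨P, a, b, hP, rfl⟩
    obtain ⟨θ, hθ⟩ := exists_average_of_projective P
    refine ⟨b.hom.toLinearMap ∘ₗ θ ∘ₗ a.hom.toLinearMap, ?_⟩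
    rw [← average_comp (M := M) (N := P), ← comp_average (M := M) (N := P), hθ, Category.comp_id]
  · rintro ⟨φ, rfl⟩
    refine ⟨functions M, toFunctions M,
      average (M := functions M) (N := N) (φ ∘ₗ functionsEval M 1), inferInstance, ?_⟩
    rw [comp_average]
    congr 1
    ext m
    simp [functionsEval_toFunctions]

end Averaging

/-! ### Calculus of stable maps and stable retracts. -/

section Stable

variable {k G : Type u} [Field k] [Group G]

lemma StablyTrivial.comp {M N L : Rep.{u} k G} {f : M ⟶ N} (hf : StablyTrivial f) (g : N ⟶ L) :
    StablyTrivial (f ≫ g) := by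
  obtain ⟨P, a, b, hP, rfl⟩ := hf
  exact ⟨P, a, b ≫ g, hP, by simp⟩

lemma StablyTrivial.precomp {M N L : Rep.{u} k G} {g : N ⟶ L} (hg : StablyTrivial g) (f : M ⟶ N) :
    StablyTrivial (f ≫ g) := by
  obtain ⟨P, a, b, hP, rfl⟩ := hg
  exact ⟨P, f ≫ a, b, hP, by simp⟩

lemma StablyTrivial.add {M N : Rep.{u} k G} {f g : M ⟶ N} (hf : StablyTrivial f)
    (hg : StablyTrivial g) : StablyTrivial (f + g) := by
  obtain ⟨P, a, b, hP, rfl⟩ := hf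
  obtain ⟨Q, c, d, hQ, rfl⟩ := hg
  exact ⟨P ⊞ Q, biprod.lift a c, biprod.desc b d, inferInstance, by simp⟩

lemma StablyTrivial.neg {M N : Rep.{u} k G} {f : M ⟶ N} (hf : StablyTrivial f) :
    StablyTrivial (-f) := by
  obtain ⟨P, a, b, hP, rfl⟩ := hf
  exact ⟨P, a, -b, hP, by simp⟩

lemma stablyTrivial_neg_iff {M N : Rep.{u} k G} {f : M ⟶ N} :
    StablyTrivial (-f) ↔ StablyTrivial f :=
  ⟨fun h => by simpa using h.neg, StablyTrivial.neg⟩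

lemma StablyTrivial.sub {M N : Rep.{u} k G} {f g : M ⟶ N} (hf : StablyTrivial f)
    (hg : StablyTrivial g) : StablyTrivial (f - g) := by
  rw [sub_eq_add_neg]
  exact hf.add hg.neg

lemma stablyTrivial_of_projective_left {M N : Rep.{u} k G} [Projective M] (f : M ⟶ N) :
    StablyTrivial f := ⟨M, 𝟙 M, f, inferInstance, by simp⟩

lemma stablyTrivial_zero {M N : Rep.{u} k G} : StablyTrivial (0 : M ⟶ N) :=
  ⟨Projective.over N, 0, 0, inferInstance, by simp⟩

lemma projective_of_stablyTrivial_id {M : Rep.{u} k G} (h : StablyTrivial (𝟙 M)) :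
    Projective M := by
  obtain ⟨P, a, b, hP, hab⟩ := h
  exact (Retract.mk a b hab).projective

lemma StablyEq.refl {M N : Rep.{u} k G} (f : M ⟶ N) : StablyEq f f := by
  rw [StablyEq, sub_self]
  exact stablyTrivial_zero

lemma StablyEq.stablyTrivial_iff {M N : Rep.{u} k G} {f g : M ⟶ N} (h : StablyEq f g) :
    StablyTrivial f ↔ StablyTrivial g :=
  ⟨fun hf => by simpa using hf.sub h, fun hg => by simpa using StablyTrivial.add h hg⟩

lemma StablyEq.comp {M N L : Rep.{u} k G} {f g : M ⟶ N} (h : StablyEq f g) (e : N ⟶ L) :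
    StablyEq (f ≫ e) (g ≫ e) := by
  rw [StablyEq, ← Preadditive.sub_comp]
  exact StablyTrivial.comp h e

lemma StablyEq.precomp {M N L : Rep.{u} k G} {f g : N ⟶ L} (h : StablyEq f g) (e : M ⟶ N) :
    StablyEq (e ≫ f) (e ≫ g) := by
  rw [StablyEq, ← Preadditive.comp_sub]
  exact StablyTrivial.precomp h e

lemma StablyEq.trans {M N : Rep.{u} k G} {f g e : M ⟶ N} (h : StablyEq f g) (h' : StablyEq g e) :
    StablyEq f e := by
  simpa [StablyEq] using StablyTrivial.add h h'

lemma StableRetract.refl (M : Rep.{u} k G) : StableRetract M M :=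
  ⟨𝟙 M, 𝟙 M, by simpa using StablyEq.refl _⟩

lemma StableRetract.trans {M N L : Rep.{u} k G} (h : StableRetract M N) (h' : StableRetract N L) :
    StableRetract M L := by
  obtain ⟨i, r, hir⟩ := h
  obtain ⟨j, s, hjs⟩ := h'
  refine ⟨i ≫ j, s ≫ r, StablyEq.trans ?_ hir⟩
  simpa using (hjs.precomp i).comp r

lemma StableRetract.projective {M N : Rep.{u} k G} (h : StableRetract M N) [Projective N] :
    Projective M := by
  obtain ⟨i, r, hir⟩ := h
  exact projective_of_stablyTrivial_id
    (hir.stablyTrivial_iff.1 ((stablyTrivial_of_projective_left r).precomp i))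

lemma InFn.of_stableRetract {n : ℕ} {M N : Rep.{u} k G} (h : StableRetract M N) (hN : InFn n N) :
    InFn n M := by
  cases n with
  | zero =>
    have : Projective N := hN
    exact h.projective
  | succ n =>
    obtain ⟨S, hS, h₁, h₃, h₂⟩ := hN
    exact ⟨S, hS, h₁, h₃, h.trans h₂⟩

end Stable

/-! ### Dimension shifting for stable maps. -/

section Shift

variable {k G : Type u} [Field k] [Group G]

/-- Extending the factorization of `φ.τ₁` over `S.X₂` and subtracting it from `φ.τ₂` leaves a map
that descends to `S.X₃ ⟶ T.X₂`; thus `φ.τ₃` factors through `T.X₂`. -/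
lemma stablyTrivial_τ₃_of_τ₁ {S T : ShortComplex (Rep.{u} k G)} (hS : S.ShortExact)
    (φ : S ⟶ T) [Projective T.X₂] (hinj : ∀ P : Rep.{u} k G, Projective P → Injective P)
    (h : StablyTrivial φ.τ₁) : StablyTrivial φ.τ₃ := by
  obtain ⟨Q, a, b, hQ, hab⟩ := h
  have := hinj Q hQ
  have := hS.mono_f
  have := hS.epi_g
  let v := Injective.factorThru a S.f
  have hv : S.f ≫ v = a := Injective.comp_factorThru a S.f
  have hz : S.f ≫ (φ.τ₂ - v ≫ b ≫ T.f) = 0 := by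
    rw [Preadditive.comp_sub, ← φ.comm₁₂, ← hab, ← hv]
    simp
  have hw := hS.exact.g_desc _ hz
  refine ⟨T.X₂, hS.exact.desc _ hz, T.g, inferInstance, ?_⟩
  rw [← cancel_epi S.g, reassoc_of% hw, ← φ.comm₂₃, Preadditive.sub_comp]
  simp

lemma stablyTrivial_τ₁_of_τ₃ {S T : ShortComplex (Rep.{u} k G)} (hT : T.ShortExact)
    (φ : S ⟶ T) [Projective S.X₂] (h : StablyTrivial φ.τ₃) : StablyTrivial φ.τ₁ := by
  obtain ⟨Q, a, b, hQ, hab⟩ := h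
  have := hT.mono_f
  have := hT.epi_g
  let v := Projective.factorThru b T.g
  have hv : v ≫ T.g = b := Projective.factorThru_comp b T.g
  have hz : (φ.τ₂ - S.g ≫ a ≫ v) ≫ T.g = 0 := by
    rw [Preadditive.sub_comp, φ.comm₂₃, ← hab, ← hv]
    simp
  have hw := hT.exact.lift_f _ hz
  refine ⟨S.X₂, S.f, hT.exact.lift _ hz, inferInstance, ?_⟩
  rw [← cancel_mono T.f, Category.assoc, hw, φ.comm₁₂, Preadditive.comp_sub]
  simp

lemma stablyTrivial_τ₁_iff_τ₃ [Finite G] {S T : ShortComplex (Rep.{u} k G)} (hS : S.ShortExact)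
    (hT : T.ShortExact) (φ : S ⟶ T) [Projective S.X₂] [Projective T.X₂] :
    StablyTrivial φ.τ₁ ↔ StablyTrivial φ.τ₃ := by
  have := Fintype.ofFinite G
  exact ⟨stablyTrivial_τ₃_of_τ₁ hS φ fun P hP => (projective_iff_injective P).1 hP,
    stablyTrivial_τ₁_of_τ₃ hT φ⟩

lemma exists_shortExact_left (M : Rep.{u} k G) :
    ∃ S : ShortComplex (Rep.{u} k G), S.ShortExact ∧ Projective S.X₂ ∧ S.X₃ = M := by
  refine ⟨ShortComplex.mk (kernel.ι (Projective.π M)) (Projective.π M) (by simp), ?_,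
    Projective.projective_over M, rfl⟩
  exact { exact := ShortComplex.exact_kernel _ }

lemma exists_shortExact_right [Finite G] (M : Rep.{u} k G) :
    ∃ S : ShortComplex (Rep.{u} k G), S.ShortExact ∧ Projective S.X₂ ∧ S.X₁ = M := by
  have := Fintype.ofFinite G
  refine ⟨ShortComplex.mk (toFunctions M) (cokernel.π (toFunctions M)) (by simp), ?_,
    instProjectiveFunctions M, rfl⟩
  exact { exact := ShortComplex.exact_cokernel _ }

/-- A map extends to a map of short exact sequences if the middle term of the target is
injective. -/
lemma exists_hom_of_τ₁ {S T : ShortComplex (Rep.{u} k G)} (hS : S.ShortExact)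
    [Injective T.X₂] (f : S.X₁ ⟶ T.X₁) : ∃ φ : S ⟶ T, φ.τ₁ = f := by
  have := hS.mono_f
  have := hS.epi_g
  let v := Injective.factorThru (f ≫ T.f) S.f
  have hv : S.f ≫ v = f ≫ T.f := Injective.comp_factorThru _ _
  have hz : S.f ≫ v ≫ T.g = 0 := by rw [reassoc_of% hv, T.zero, comp_zero]
  exact ⟨ShortComplex.Hom.mk f v (hS.exact.desc _ hz) hv.symm (hS.exact.g_desc _ hz).symm, rfl⟩

/-- A map extends to a map of short exact sequences if the middle term of the source is
projective. -/
lemma exists_hom_of_τ₃ {S T : ShortComplex (Rep.{u} k G)} (hT : T.ShortExact)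
    [Projective S.X₂] (f : S.X₃ ⟶ T.X₃) : ∃ φ : S ⟶ T, φ.τ₃ = f := by
  have := hT.mono_f
  have := hT.epi_g
  let v := Projective.factorThru (S.g ≫ f) T.g
  have hv : v ≫ T.g = S.g ≫ f := Projective.factorThru_comp _ _
  have hz : (S.f ≫ v) ≫ T.g = 0 := by rw [Category.assoc, hv, S.zero_assoc, zero_comp]
  exact ⟨ShortComplex.Hom.mk (hT.exact.lift _ hz) v f (hT.exact.lift_f _ hz) hv, rfl⟩

end Shift

/-! ### Tate cohomology as stable maps out of `Ω^n k`. -/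

section Tate

variable {k G : Type u} [Field k] [Group G]

lemma shortComplex_homologyMap_eq_zero_iff {S T : ShortComplex (ModuleCat.{u} k)} (φ : S ⟶ T) :
    ShortComplex.homologyMap φ = 0 ↔ ∀ x : S.X₂, S.g x = 0 → ∃ y : T.X₁, T.f y = φ.τ₂ x := by
  have hπ : ∀ z : T.cycles, T.homologyπ z = 0 → ∃ y : T.X₁, T.toCycles y = z := by
    have : (ShortComplex.mk T.toCycles T.homologyπ (by simp)).Exact :=
      ShortComplex.exact_of_g_is_cokernel _ T.homologyIsCokernel
    exact (ShortComplex.moduleCat_exact_iff _).1 this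
  constructor
  · intro h x hx
    let z : S.cycles := S.moduleCatCyclesIso.inv ⟨x, hx⟩
    have hz : S.iCycles z = x :=
      ConcreteCategory.congr_hom S.moduleCatCyclesIso_inv_iCycles ⟨x, hx⟩
    obtain ⟨y, hy⟩ := hπ (ShortComplex.cyclesMap φ z) (by
      have := ConcreteCategory.congr_hom (ShortComplex.homologyπ_naturality φ) z
      rw [h] at this
      simpa using this.symm)
    refine ⟨y, ?_⟩
    have h1 := ConcreteCategory.congr_hom T.toCycles_i y
    have h2 := ConcreteCategory.congr_hom (ShortComplex.cyclesMap_i φ) z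
    simp only [ConcreteCategory.comp_apply] at h1 h2
    rw [← h1, hy, h2, hz]
  · intro h
    rw [← cancel_epi S.homologyπ, comp_zero, ShortComplex.homologyπ_naturality]
    ext z
    obtain ⟨y, hy⟩ := h (S.iCycles z) (ConcreteCategory.congr_hom S.iCycles_g z)
    have : T.toCycles y = ShortComplex.cyclesMap φ z := by
      apply (ModuleCat.mono_iff_injective T.iCycles).1 inferInstance
      have h1 := ConcreteCategory.congr_hom T.toCycles_i y
      have h2 := ConcreteCategory.congr_hom (ShortComplex.cyclesMap_i φ) z
      simp only [ConcreteCategory.comp_apply] at h1 h2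
      rw [h1, h2, hy]
    simp [← this, ← ConcreteCategory.comp_apply]

lemma homologyMap_eq_zero_iff {K L : CochainComplex (ModuleCat.{u} k) ℤ} (φ : K ⟶ L) (i j l : ℤ)
    (hi : i + 1 = j) (hl : j + 1 = l) :
    HomologicalComplex.homologyMap φ j = 0 ↔
      ∀ x : K.X j, K.d j l x = 0 → ∃ y : L.X i, L.d i j y = φ.f j x := by
  obtain rfl : (ComplexShape.up ℤ).prev j = i := by simp [← hi]
  obtain rfl : (ComplexShape.up ℤ).next j = l := by simp [← hl]
  exact shortComplex_homologyMap_eq_zero_iff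
    ((HomologicalComplex.shortComplexFunctor (ModuleCat k) (ComplexShape.up ℤ) j).map φ)

variable [Fintype G]

open groupCohomology groupHomology

omit [Fintype G] in
lemma d₀₁_eq_zero_iff (M : Rep.{u} k G) (m : M.V) : d₀₁ M m = 0 ↔ ∀ g, M.ρ g m = m := by
  refine funext_iff.trans (forall_congr' fun g => ?_)
  change M.ρ g m - m = 0 ↔ _
  exact sub_eq_zero

omit [Fintype G] in
lemma inhomogeneousCochains_d_eq_zero_iff (M : Rep.{u} k G) (m : M.V) :
    (inhomogeneousCochains M).d 0 1 ((cochainsIso₀ M).inv m) = 0 ↔ ∀ g, M.ρ g m = m := by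
  rw [← d₀₁_eq_zero_iff]
  have h₁ := ConcreteCategory.congr_hom (eq_d₀₁_comp_inv M) m
  have h₂ := (ModuleCat.mono_iff_injective (cochainsIso₁ M).inv).1 inferInstance
  simp only [ConcreteCategory.comp_apply] at h₁
  rw [h₁]
  exact map_eq_zero_iff _ h₂

lemma tateNorm_apply (M : Rep.{u} k G) (y : (inhomogeneousChains M).X 0) :
    M.tateNorm y = (cochainsIso₀ M).inv (M.ρ.norm ((chainsIso₀ M).hom y)) := rfl

omit [Fintype G] in
lemma cochainsIso₀_inv_injective (M : Rep.{u} k G) :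
    Function.Injective (cochainsIso₀ M).inv :=
  (ModuleCat.mono_iff_injective _).1 inferInstance

/-- The differential from degree `-1` to `0` is the norm, so degree `0` is invariants modulo norms.
-/
lemma tateCohomology_map_zero_iff {M N : Rep.{u} k G} (f : M ⟶ N) :
    (tateCohomologyFunctor 0).map f = 0 ↔
      ∀ m : M.V, (∀ g, M.ρ g m = m) → ∃ n : N.V, N.ρ.norm n = f.hom m := by
  refine (homologyMap_eq_zero_iff (tateComplex.map f) (-1) 0 1 rfl rfl).trans ?_
  constructor
  · intro h m hm
    obtain ⟨y, hy⟩ := h ((cochainsIso₀ M).inv m) ((inhomogeneousCochains_d_eq_zero_iff M m).2 hm)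
    exact ⟨(chainsIso₀ N).hom y, cochainsIso₀_inv_injective N hy⟩
  · intro h x hx
    obtain ⟨m, rfl⟩ : ∃ m, (cochainsIso₀ M).inv m = x :=
      (ModuleCat.epi_iff_surjective (cochainsIso₀ M).inv).1 inferInstance x
    obtain ⟨n, hn⟩ := h m ((inhomogeneousCochains_d_eq_zero_iff M m).1 hx)
    refine ⟨(chainsIso₀ N).inv n, ?_⟩
    refine (tateNorm_apply N _).trans ?_
    rw [← ConcreteCategory.comp_apply, Iso.inv_hom_id, ConcreteCategory.id_apply, hn]
    rfl

lemma norm_eq_zero_mem_coinvariantsKer (M : Rep.{u} k G) [Projective M] (m : M.V)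
    (hm : M.ρ.norm m = 0) : m ∈ Representation.Coinvariants.ker M.ρ := by
  obtain ⟨θ, hθ⟩ := exists_average_of_projective M
  have h₁ : ∑ g : G, M.ρ g (θ (M.ρ g⁻¹ m)) = m := by
    rw [← average_apply, hθ, Rep.id_apply]
  have h₂ : ∑ g : G, θ (M.ρ g⁻¹ m) = 0 := by
    rw [← map_sum, Fintype.sum_equiv (Equiv.inv G) (fun g => M.ρ g⁻¹ m) (fun g => M.ρ g m)
      (fun g => rfl)]
    simpa [Representation.norm] using congrArg θ hm
  -- Now `m` is the sum of the elements `g y - y` with `y = θ (g⁻¹ m)`.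
  rw [← h₁, ← sub_zero (∑ g : G, M.ρ g (θ (M.ρ g⁻¹ m))), ← h₂, ← Finset.sum_sub_distrib]
  exact Submodule.sum_mem _ fun g _ => Representation.Coinvariants.sub_mem_ker g _

lemma isZero_tateCohomology_neg_one (M : Rep.{u} k G) [Projective M] :
    IsZero (tateCohomology M (-1)) := by
  rw [IsZero.iff_id_eq_zero, ← CategoryTheory.Functor.map_id]
  refine (homologyMap_eq_zero_iff (tateComplex.map (𝟙 M)) (-2) (-1) 0 rfl rfl).2 fun x hx => ?_
  have h₀ : M.ρ.norm ((chainsIso₀ M).hom x) = 0 :=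
    (map_eq_zero_iff _ (cochainsIso₀_inv_injective M)).1 hx
  have h₁ := norm_eq_zero_mem_coinvariantsKer M _ h₀
  rw [← range_d₁₀_eq_coinvariantsKer] at h₁
  obtain ⟨y, hy⟩ := h₁
  refine ⟨(chainsIso₁ M).inv y, ?_⟩
  have h₂ := ConcreteCategory.congr_hom (eq_d₁₀_comp_inv M) y
  refine h₂.trans ?_
  have h₃ : ∀ z : (inhomogeneousChains M).X 0, (chainsIso₀ M).inv ((chainsIso₀ M).hom z) = z :=
    fun z => ConcreteCategory.congr_hom (chainsIso₀ M).hom_inv_id z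
  refine ((congrArg (chainsIso₀ M).inv hy).trans (h₃ x)).trans ?_
  exact (ConcreteCategory.congr_hom
    (congrArg (fun φ => HomologicalComplex.Hom.f φ (-1))
      ((tateComplexFunctor k G).map_id M)) x).symm

lemma isZero_tateCohomology_zero (M : Rep.{u} k G) [Projective M] :
    IsZero (tateCohomology M 0) := by
  rw [IsZero.iff_id_eq_zero, ← CategoryTheory.Functor.map_id]
  refine (tateCohomology_map_zero_iff (𝟙 M)).2 fun m hm => ?_
  obtain ⟨θ, hθ⟩ := exists_average_of_projective M
  refine ⟨θ m, ?_⟩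
  rw [← hθ, average_apply]
  simp [hm, Representation.norm]

/-- `M` is injective, hence a retract of a module coinduced from the trivial subgroup; Shapiro's
lemma applies. Negative degrees are dual, with induction. -/
lemma isZero_tateCohomology_of_pos (M : Rep.{u} k G) [Projective M] (n : ℕ) :
    IsZero (tateCohomology M ((n + 1 : ℕ) : ℤ)) := by
  have : Injective M := (projective_iff_injective M).1 inferInstance
  let adj := Rep.resCoindAdjunction k (⊥ : Subgroup G).subtype
  have := adj.unit_mono_of_L_faithful M
  let r := Retract.mk (adj.unit.app M) (Injective.factorThru (𝟙 M) (adj.unit.app M)) (by simp)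
  refine IsZero.of_iso ?_ ((TateCohomology.isoGroupCohomology (n + 1)).app M)
  have r' := r.map (groupCohomology.functor k G (n + 1))
  refine IsZero.of_mono r'.i ?_
  exact (isZero_groupCohomology_succ_of_subsingleton _ n).of_iso (groupCohomology.coindIso _ (n + 1))
lemma isZero_tateCohomology_of_neg (M : Rep.{u} k G) [Projective M] (n : ℕ) :
    IsZero (tateCohomology M (-((n + 1 : ℕ) + 1))) := by
  classical
  let adj := Rep.indResAdjunction k (⊥ : Subgroup G).subtype
  have := adj.counit_epi_of_R_faithful M
  let r := Retract.mk (Projective.factorThru (𝟙 M) (adj.counit.app M)) (adj.counit.app M) (by simp)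
  refine IsZero.of_iso ?_ ((TateCohomology.isoGroupHomology _ (n + 1) rfl).app M)
  have r' := r.map (groupHomology.functor k G (n + 1))
  refine IsZero.of_mono r'.i ?_
  exact (isZero_groupHomology_succ_of_subsingleton _ n).of_iso (groupHomology.indIso _ _ (n + 1))

lemma isZero_tateCohomology (M : Rep.{u} k G) [Projective M] (n : ℤ) :
    IsZero (tateCohomology M n) := by
  match n with
  | .ofNat 0 => exact isZero_tateCohomology_zero M
  | .ofNat (n + 1) => exact isZero_tateCohomology_of_pos M n
  | .negSucc 0 => exact isZero_tateCohomology_neg_one M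
  | .negSucc (n + 1) => exact isZero_tateCohomology_of_neg M n

lemma tateCohomology_map_τ₁_eq_zero_iff {S T : ShortComplex (Rep.{u} k G)} (hS : S.ShortExact)
    (hT : T.ShortExact) (φ : S ⟶ T) [Projective S.X₂] [Projective T.X₂] (n : ℤ) :
    (tateCohomologyFunctor (n + 1)).map φ.τ₁ = 0 ↔ (tateCohomologyFunctor n).map φ.τ₃ = 0 := by
  have h := TateCohomology.δ_naturality hS hT φ n
  have : Epi (TateCohomology.δ hS n) := (TateCohomology.exact₁ hS n).epi_f
    ((isZero_tateCohomology S.X₂ (n + 1)).eq_of_tgt _ _)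
  have : Mono (TateCohomology.δ hT n) := (TateCohomology.exact₃ hT n).mono_g
    ((isZero_tateCohomology T.X₂ n).eq_of_src _ _)
  rw [← cancel_epi (TateCohomology.δ hS n), h, comp_zero, ← zero_comp, cancel_mono]

lemma average_trivial_apply_one {N : Rep.{u} k G} (φ : k →ₗ[k] N.V) :
    (average (M := Rep.trivial k G k) (N := N) φ).hom (1 : k) = N.ρ.norm (φ 1) := by
  refine (average_apply (M := Rep.trivial k G k) (N := N) φ (1 : k)).trans ?_
  simp [Representation.norm]

/-- Invariants are maps out of `k`, and the averages among these are the norms. -/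
lemma tateCohomology_map_zero_iff_stablyTrivial {M N : Rep.{u} k G} (f : M ⟶ N) :
    (tateCohomologyFunctor 0).map f = 0 ↔
      ∀ a : Rep.trivial k G k ⟶ M, StablyTrivial (a ≫ f) := by
  rw [tateCohomology_map_zero_iff]
  constructor
  · intro h a
    obtain ⟨n, hn⟩ := h (a.hom (1 : k)) fun g => by rw [← Rep.hom_comm_apply]; rfl
    refine (stablyTrivial_iff_exists_average _).2 ⟨LinearMap.toSpanSingleton k N.V n, ?_⟩
    ext
    refine (average_trivial_apply_one _).trans ?_
    rw [LinearMap.toSpanSingleton_apply, one_smul, hn]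
    rfl
  · intro h m hm
    let a : Rep.trivial k G k ⟶ M := Rep.ofHom (ρ := (Rep.trivial k G k).ρ) (σ := M.ρ)
      ⟨LinearMap.toSpanSingleton k M.V m, fun g => by ext; simp [hm]⟩
    obtain ⟨φ, hφ⟩ := (stablyTrivial_iff_exists_average _).1 (h a)
    refine ⟨φ (1 : k), ?_⟩
    rw [← average_trivial_apply_one, hφ]
    exact congrArg f.hom (one_smul k m)

/-- Both sides shift along short exact sequences with projective middle term, which reduces the
claim to degree `0`. -/
lemma tateCohomology_map_eq_zero_iff {n : ℤ} {S : Rep.{u} k G} (hS : IsOmega n S)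
    {M N : Rep.{u} k G} (f : M ⟶ N) :
    (tateCohomologyFunctor n).map f = 0 ↔ ∀ a : S ⟶ M, StablyTrivial (a ≫ f) := by
  induction hS generalizing M N with
  | trivial => exact tateCohomology_map_zero_iff_stablyTrivial f
  | omega n S hS hP h ih =>
    obtain ⟨T, hT, hTP, rfl⟩ := exists_shortExact_right M
    obtain ⟨U, hU, hUP, rfl⟩ := exists_shortExact_right N
    have := (projective_iff_injective T.X₂).1 hTP
    have := (projective_iff_injective U.X₂).1 hUP
    obtain ⟨φ, rfl⟩ := exists_hom_of_τ₁ hT f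
    rw [tateCohomology_map_τ₁_eq_zero_iff hT hU φ n, ih φ.τ₃]
    constructor
    · intro h a
      obtain ⟨α, rfl⟩ := exists_hom_of_τ₁ (T := T) hS a
      exact (stablyTrivial_τ₁_iff_τ₃ hS hU (α ≫ φ)).2 (h α.τ₃)
    · intro h c
      obtain ⟨α, rfl⟩ := exists_hom_of_τ₃ (S := S) hT c
      exact (stablyTrivial_τ₁_iff_τ₃ hS hU (α ≫ φ)).1 (h α.τ₁)
  | sigma n S hS hI h ih =>
    have := (projective_iff_injective S.X₂).2 hI
    obtain ⟨T, hT, hTP, rfl⟩ := exists_shortExact_left M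
    obtain ⟨U, hU, hUP, rfl⟩ := exists_shortExact_left N
    have := (projective_iff_injective T.X₂).1 hTP
    have := (projective_iff_injective U.X₂).1 hUP
    obtain ⟨φ, rfl⟩ := exists_hom_of_τ₃ hU f
    have hn := tateCohomology_map_τ₁_eq_zero_iff hT hU φ (n - 1)
    rw [sub_add_cancel] at hn
    rw [← hn, ih φ.τ₁]
    constructor
    · intro h c
      obtain ⟨α, rfl⟩ := exists_hom_of_τ₃ (S := S) hT c
      exact (stablyTrivial_τ₁_iff_τ₃ hS hU (α ≫ φ)).1 (h α.τ₁)
    · intro h a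
      obtain ⟨α, rfl⟩ := exists_hom_of_τ₁ (T := T) hS a
      exact (stablyTrivial_τ₁_iff_τ₃ hS hU (α ≫ φ)).2 (h α.τ₃)

omit [Fintype G] in
lemma exists_isOmega [Finite G] (n : ℤ) : ∃ S : Rep.{u} k G, IsOmega n S := by
  have := Fintype.ofFinite G
  induction n using Int.induction_on with
  | zero => exact ⟨_, IsOmega.trivial⟩
  | succ n ih =>
    obtain ⟨M, hM⟩ := ih
    obtain ⟨S, hS, hP, rfl⟩ := exists_shortExact_left M
    exact ⟨_, IsOmega.omega _ S hS hP hM⟩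
  | pred n ih =>
    obtain ⟨M, hM⟩ := ih
    obtain ⟨S, hS, hP, rfl⟩ := exists_shortExact_right M
    exact ⟨_, IsOmega.sigma _ S hS ((projective_iff_injective _).1 hP) hM⟩

lemma isGhost_iff {M N : Rep.{u} k G} (f : M ⟶ N) :
    IsGhost f ↔ ∀ (n : ℤ) (S : Rep.{u} k G), IsOmega n S → ∀ a : S ⟶ M, StablyTrivial (a ≫ f) := by
  refine ⟨fun h n S hS => (tateCohomology_map_eq_zero_iff hS f).1 (h n), fun h n => ?_⟩
  obtain ⟨S, hS⟩ := exists_isOmega (k := k) (G := G) n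
  exact (tateCohomology_map_eq_zero_iff hS f).2 (h n S hS)

end Tate

/-! ### The ghost lemma and its converse. -/

section Ghosts

variable {k G : Type u} [Field k] [Group G] [Fintype G]

lemma IsGhost.comp {M N L : Rep.{u} k G} {f : M ⟶ N} (hf : IsGhost f) (g : N ⟶ L) :
    IsGhost (f ≫ g) := fun n => by rw [Functor.map_comp, hf n, zero_comp]

lemma IsGhost.precomp {M N L : Rep.{u} k G} {g : N ⟶ L} (hg : IsGhost g) (f : M ⟶ N) :
    IsGhost (f ≫ g) := fun n => by rw [Functor.map_comp, hg n, comp_zero]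

/-- A ghost is stably trivial on the class `F`. -/
lemma IsGhost.stablyTrivial_of_inF {M N : Rep.{u} k G} {f : M ⟶ N} (hf : IsGhost f)
    (hM : InF M) : StablyTrivial f := by
  obtain ⟨ι, S, hS, i, r, hir⟩ := hM
  have h : ∀ j, StablyTrivial (Sigma.ι S j ≫ r ≫ f) := fun j => by
    obtain ⟨n, hn⟩ := hS j
    rw [← Category.assoc]
    exact (isGhost_iff f).1 hf n (S j) hn _
  choose P a b hP hab using h
  -- The factorizations on the summands assemble because a coproduct of projectives is projective.
  have hr : StablyTrivial (r ≫ f) :=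
    ⟨∐ P, Limits.Sigma.desc fun j => a j ≫ Limits.Sigma.ι P j, Limits.Sigma.desc b, inferInstance,
      Limits.Sigma.hom_ext _ _ fun j => by simp [hab]⟩
  simpa using (hir.comp f).stablyTrivial_iff.1 (by simpa using hr.precomp i)

/-- The composites of `n` ghosts between arbitrary modules. -/
def IsGhostComposite : ℕ → ∀ {M N : Rep.{u} k G}, (M ⟶ N) → Prop
  | 0, _, _, _ => True
  | n + 1, M, N, f => ∃ (Y : Rep.{u} k G) (g : M ⟶ Y) (h : Y ⟶ N),
      IsGhost g ∧ IsGhostComposite n h ∧ g ≫ h = f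

lemma IsGhostComposite.of_succ {n : ℕ} {M N : Rep.{u} k G} {f : M ⟶ N}
    (hf : IsGhostComposite (n + 1) f) : IsGhostComposite n f := by
  induction n generalizing M with
  | zero => trivial
  | succ n ih =>
    obtain ⟨Y, g, h, hg, hh, rfl⟩ := hf
    exact ⟨Y, g, h, hg, ih hh, rfl⟩

/-- A map that is stably trivial on the kernel term of a short exact sequence factors, up to a
stably trivial map, through the cokernel term. -/
lemma exists_stablyEq_comp {S : ShortComplex (Rep.{u} k G)} (hS : S.ShortExact) {Y : Rep.{u} k G}
    (f : S.X₂ ⟶ Y) (hf : StablyTrivial (S.f ≫ f)) : ∃ g : S.X₃ ⟶ Y, StablyEq f (S.g ≫ g) := by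
  obtain ⟨P, a, b, hP, hab⟩ := hf
  have := (projective_iff_injective P).1 hP
  have := hS.mono_f
  have := hS.epi_g
  let v := Injective.factorThru a S.f
  have hv : S.f ≫ v = a := Injective.comp_factorThru a S.f
  have hz : S.f ≫ (f - v ≫ b) = 0 := by rw [Preadditive.comp_sub, reassoc_of% hv, hab, sub_self]
  refine ⟨hS.exact.desc _ hz, ?_⟩
  rw [StablyEq, hS.exact.g_desc, sub_sub_cancel]
  exact ⟨P, v, b, hP, rfl⟩

/-- The first ghost vanishes stably on the part in `F`, so it factors through the quotient in `F_n`,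
where the remaining `n` ghosts compose to a stably trivial map. -/
lemma IsGhostComposite.stablyTrivial {n : ℕ} {M N : Rep.{u} k G} {f : M ⟶ N}
    (hf : IsGhostComposite n f) (hM : InFn n M) : StablyTrivial f := by
  induction n generalizing M with
  | zero =>
    have : Projective M := hM
    exact stablyTrivial_of_projective_left f
  | succ n ih =>
    obtain ⟨Y, g, h, hg, hh, rfl⟩ := hf
    obtain ⟨S, hS, h₁, h₃, i, r, hir⟩ := hM
    obtain ⟨e, he⟩ := exists_stablyEq_comp hS (r ≫ g)
      (((hg.precomp r).precomp S.f).stablyTrivial_of_inF h₁)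
    have hcomp : ∀ {n : ℕ} {A B C : Rep.{u} k G} (a : A ⟶ B) {b : B ⟶ C},
        IsGhostComposite n b → IsGhostComposite n (a ≫ b) := by
      intro n A B C a b hb
      cases n with
      | zero => trivial
      | succ n =>
        obtain ⟨Y, g, h, hg, hh, rfl⟩ := hb
        exact ⟨Y, a ≫ g, h, hg.precomp a, hh, by simp⟩
    have h₂ := (ih (hcomp e hh) h₃).precomp S.g
    have h₄ : StablyTrivial ((r ≫ g) ≫ h) := (he.comp h).stablyTrivial_iff.2 (by simpa using h₂)
    have h₅ := (hir.comp (g ≫ h)).stablyTrivial_iff.1 (by simpa using h₄.precomp i)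
    simpa using h₅

/-- The universal ghost out of `M`. -/
lemma exists_universal_ghost (M : Rep.{u} k G) :
    ∃ (S : ShortComplex (Rep.{u} k G)) (i : M ⟶ S.X₂) (r : S.X₂ ⟶ M),
      S.ShortExact ∧ i ≫ r = 𝟙 M ∧ InF S.X₁ ∧ IsGhost (i ≫ S.g) := by
  choose Ω hΩ using exists_isOmega (k := k) (G := G)
  let T : (Σ n : ℤ, (Ω n ⟶ M)) → Rep.{u} k G := fun j => Ω j.1
  let π : ∐ T ⟶ M := Sigma.desc fun j => j.2
  -- Adding an embedding into a projective module makes `π` a monomorphism without changing it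
  -- stably; its cokernel then models the cofibre of `π`.
  let j := toFunctions (∐ T)
  let c := biprod.lift π j
  have : Mono c := by
    have : Mono (c ≫ biprod.snd) := by simpa [c] using inferInstanceAs (Mono j)
    exact mono_of_mono c biprod.snd
  refine ⟨ShortComplex.mk c (cokernel.π c) (by simp), (biprod.inl : M ⟶ M ⊞ functions (∐ T)),
    (biprod.fst : M ⊞ functions (∐ T) ⟶ M), { exact := ShortComplex.exact_cokernel _ }, by simp,
    ⟨_, T, fun j => ⟨j.1, hΩ j.1⟩, StableRetract.refl _⟩, fun n => ?_⟩
  refine (tateCohomology_map_eq_zero_iff (hΩ n) _).2 fun a => ?_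
  have h₀ : a = Sigma.ι T ⟨n, a⟩ ≫ π := by simp [π]
  have h₁ : π ≫ biprod.inl + j ≫ biprod.inr = c := by
    apply biprod.hom_ext <;> simp [c]
  -- In the cokernel of `c` the two components cancel, so the map equals one through the projective
  -- summand.
  have h₂ : a ≫ biprod.inl ≫ cokernel.π c =
      -(Sigma.ι T ⟨n, a⟩ ≫ j ≫ biprod.inr ≫ cokernel.π c) := by
    have h₃ : a ≫ biprod.inl ≫ cokernel.π c =
        Sigma.ι T ⟨n, a⟩ ≫ π ≫ biprod.inl ≫ cokernel.π c := by
      rw [← Category.assoc (Sigma.ι T _), ← h₀]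
    rw [eq_neg_iff_add_eq_zero, h₃]
    have := congrArg (fun e => Sigma.ι T ⟨n, a⟩ ≫ e ≫ cokernel.π c) h₁
    simpa [Preadditive.add_comp] using this
  rw [h₂]
  exact StablyTrivial.neg ⟨_, Sigma.ι T ⟨n, a⟩ ≫ j, biprod.inr ≫ cokernel.π c,
    instProjectiveFunctions _, by simp⟩

omit [Fintype G] in
lemma shortExact_pullback {S : ShortComplex (Rep.{u} k G)} (hS : S.ShortExact) {Y : Rep.{u} k G}
    (f : Y ⟶ S.X₃) : (ShortComplex.mk (pullback.lift S.f 0 (by simp) : S.X₁ ⟶ pullback S.g f)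
      (pullback.snd S.g f) (pullback.lift_snd _ _ _)).ShortExact := by
  have := hS.mono_f
  have := hS.epi_g
  have hv : (pullback.lift S.f 0 (by simp) : S.X₁ ⟶ pullback S.g f) ≫ pullback.fst S.g f = S.f :=
    pullback.lift_fst _ _ _
  have : Mono (pullback.lift S.f 0 (by simp) : S.X₁ ⟶ pullback S.g f) := mono_of_mono_fac hv
  have hz : ∀ {Z : Rep.{u} k G} (h : Z ⟶ pullback S.g f), h ≫ pullback.snd S.g f = 0 →
      (h ≫ pullback.fst S.g f) ≫ S.g = 0 := fun h hh => by
    rw [Category.assoc, pullback.condition, reassoc_of% hh, zero_comp]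
  refine { exact := ShortComplex.exact_of_f_is_kernel _ (KernelFork.IsLimit.ofι' _ _
    fun {Z} h hh => ⟨hS.exact.lift _ (hz h hh), ?_⟩) }
  apply pullback.hom_ext
  · rw [Category.assoc, pullback.lift_fst, hS.exact.lift_f]
  · rw [Category.assoc, pullback.lift_snd, comp_zero]
    exact hh.symm

omit [Fintype G] in
-- With `shortExact_pullback` this plays the role of the octahedral axiom: the fibre of a composite
-- is an extension of the two fibres.
lemma shortExact_pullback_comp {B C : Rep.{u} k G} (g : B ⟶ C) [Epi g]
    {T : ShortComplex (Rep.{u} k G)} (s : T.X₂ ⟶ C) (hT : T.ShortExact)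
    (m : pullback g (T.f ≫ s) ⟶ pullback g s) (h₁ : m ≫ pullback.fst g s = pullback.fst g (T.f ≫ s))
    (h₂ : m ≫ pullback.snd g s = pullback.snd g (T.f ≫ s) ≫ T.f) :
    (ShortComplex.mk m (pullback.snd g s ≫ T.g) (by
      rw [reassoc_of% h₂, T.zero, comp_zero])).ShortExact := by
  have := hT.mono_f
  have := hT.epi_g
  have hm : Mono m := by
    refine ⟨fun a b h => pullback.hom_ext ?_ ?_⟩
    · rw [← h₁, reassoc_of% h]
    · rw [← cancel_mono T.f, Category.assoc, Category.assoc, ← h₂, reassoc_of% h]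
  have : Epi (pullback.snd g s ≫ T.g) := epi_comp _ _
  refine { exact := ShortComplex.exact_of_f_is_kernel _ (KernelFork.IsLimit.ofι' _ _
    fun {Z} (h : Z ⟶ pullback g s) (hh : h ≫ pullback.snd g s ≫ T.g = 0) => ?_) }
  have hz : (h ≫ pullback.snd g s) ≫ T.g = 0 := by rw [Category.assoc, hh]
  have hl : (h ≫ pullback.fst g s) ≫ g = hT.exact.lift _ hz ≫ T.f ≫ s := by
    rw [hT.exact.lift_f_assoc, Category.assoc, pullback.condition, Category.assoc]
  refine ⟨pullback.lift _ _ hl, pullback.hom_ext ?_ ?_⟩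
  · rw [Category.assoc]
    exact (congrArg _ h₁).trans (pullback.lift_fst _ _ _)
  · rw [Category.assoc]
    refine (congrArg _ h₂).trans ?_
    rw [pullback.lift_snd_assoc, hT.exact.lift_f]

/-- The composite of `n` universal ghosts out of `M`, together with its fibre, a module of `F_n`. -/
lemma exists_isGhostComposite_fibre (n : ℕ) (M : Rep.{u} k G) :
    ∃ (S : ShortComplex (Rep.{u} k G)) (i : M ⟶ S.X₂) (r : S.X₂ ⟶ M),
      S.ShortExact ∧ i ≫ r = 𝟙 M ∧ InFn n S.X₁ ∧ IsGhostComposite n (i ≫ S.g) := by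
  induction n generalizing M with
  | zero =>
    refine ⟨ShortComplex.mk (0 : kernel (𝟙 M) ⟶ M) (𝟙 M) (by simp), 𝟙 M, 𝟙 M, ?_, by simp, ?_,
      trivial⟩
    · have h : IsZero (kernel (𝟙 M)) := isZero_kernel_of_mono (𝟙 M)
      have : Mono (0 : kernel (𝟙 M) ⟶ M) := ⟨fun _ _ _ => h.eq_of_tgt _ _⟩
      exact { exact := (ShortComplex.exact_iff_mono _ rfl).2 (inferInstanceAs (Mono (𝟙 M))) }
    · have h : IsZero (kernel (𝟙 M)) := isZero_kernel_of_mono (𝟙 M)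
      exact h.projective
  | succ n ih =>
    obtain ⟨S, i, r, hS, hir, hF, hg⟩ := exists_universal_ghost M
    obtain ⟨T, j, s, hT, hjs, hT₁, hT₃⟩ := ih S.X₃
    have := hS.mono_f
    have := hS.epi_g
    have := hT.mono_f
    have := hT.epi_g
    let m : pullback S.g (T.f ≫ s) ⟶ pullback S.g s :=
      pullback.lift (pullback.fst S.g (T.f ≫ s)) (pullback.snd S.g (T.f ≫ s) ≫ T.f)
        (by rw [pullback.condition, Category.assoc])
    let i' : M ⟶ pullback S.g s := pullback.lift i (i ≫ S.g ≫ j) (by simp [hjs])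
    have h₁ : i' ≫ pullback.fst S.g s = i := pullback.lift_fst _ _ _
    have h₂ : i' ≫ pullback.snd S.g s = i ≫ S.g ≫ j := pullback.lift_snd _ _ _
    have h₃ : i' ≫ pullback.fst S.g s ≫ r = 𝟙 M := by rw [reassoc_of% h₁, hir]
    have h₄ : (i ≫ S.g) ≫ j ≫ T.g = i' ≫ pullback.snd S.g s ≫ T.g := by
      rw [reassoc_of% h₂, Category.assoc]
    exact ⟨_, i', pullback.fst S.g s ≫ r,
      shortExact_pullback_comp S.g s hT m (pullback.lift_fst _ _ _) (pullback.lift_snd _ _ _), h₃,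
      ⟨_, shortExact_pullback hS (T.f ≫ s), hF, hT₁, StableRetract.refl _⟩,
      ⟨S.X₃, i ≫ S.g, j ≫ T.g, hg, hT₃, h₄⟩⟩

/-- For the converse, if the composite of `n` universal ghosts is stably trivial, the identity of
`M` lifts stably to its fibre, so `M` is a stable retract of a module of `F_n`. -/
lemma inFn_iff (n : ℕ) (M : Rep.{u} k G) :
    InFn n M ↔ ∀ (N : Rep.{u} k G) (f : M ⟶ N), IsGhostComposite n f → StablyTrivial f := by
  refine ⟨fun hM N f hf => hf.stablyTrivial hM, fun h => ?_⟩
  obtain ⟨S, i, r, hS, hir, hF, hg⟩ := exists_isGhostComposite_fibre n M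
  have := hS.mono_f
  have := hS.epi_g
  obtain ⟨Q, a, b, hQ, hab⟩ := h _ _ hg
  let b' := Projective.factorThru b S.g
  have hb : b' ≫ S.g = b := Projective.factorThru_comp _ _
  have hz : (i - a ≫ b') ≫ S.g = 0 := by
    rw [Preadditive.sub_comp, Category.assoc, hb, hab, sub_self]
  refine InFn.of_stableRetract ⟨hS.exact.lift _ hz, S.f ≫ r, ?_⟩ hF
  rw [hS.exact.lift_f_assoc, Preadditive.sub_comp, hir, StablyEq, sub_sub_cancel_left,
    Category.assoc]
  exact StablyTrivial.neg ⟨Q, a, b' ≫ r, hQ, rfl⟩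

lemma InFn.succ {n : ℕ} {M : Rep.{u} k G} (h : InFn n M) : InFn (n + 1) M :=
  (inFn_iff _ _).2 fun N f hf => (inFn_iff _ _).1 h N f hf.of_succ

end Ghosts

/-! ### The ghost `x - 1`. -/

section Central

variable {k G : Type u} [Field k] [Group G]

/-- Multiplication by `x - 1`, for a central element `x`. -/
def centralSub (x : G) (hx : x ∈ Subgroup.center G) (M : Rep.{u} k G) : M ⟶ M :=
  Rep.ofHom (ρ := M.ρ) (σ := M.ρ) ⟨M.ρ x, fun g => by
    rw [← Module.End.mul_eq_comp, ← Module.End.mul_eq_comp, ← map_mul, ← map_mul,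
      Subgroup.mem_center_iff.1 hx g]⟩ - 𝟙 M

variable (x : G) (hx : x ∈ Subgroup.center G)

lemma centralSub_apply (M : Rep.{u} k G) (m : M.V) :
    (centralSub x hx M).hom m = M.ρ x m - m := rfl

lemma centralSub_naturality {M N : Rep.{u} k G} (f : M ⟶ N) :
    f ≫ centralSub x hx N = centralSub x hx M ≫ f := by
  ext m
  change N.ρ x (f.hom m) - f.hom m = f.hom (M.ρ x m - m)
  rw [map_sub, Rep.hom_comm_apply]

/-- The powers of `x - 1`. -/
def centralSubPow (M : Rep.{u} k G) : ℕ → (M ⟶ M)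
  | 0 => 𝟙 M
  | n + 1 => centralSubPow M n ≫ centralSub x hx M

lemma centralSubPow_succ (M : Rep.{u} k G) (n : ℕ) :
    centralSubPow x hx M (n + 1) = centralSub x hx M ≫ centralSubPow x hx M n :=
  centralSub_naturality x hx _

variable [Fintype G]

lemma stablyTrivial_centralSub {n : ℤ} {S : Rep.{u} k G} (hS : IsOmega n S) :
    StablyTrivial (centralSub x hx S) := by
  let φ : ∀ S : ShortComplex (Rep.{u} k G), S ⟶ S := fun S =>
    ⟨centralSub x hx _, centralSub x hx _, centralSub x hx _,
      (centralSub_naturality x hx _).symm, (centralSub_naturality x hx _).symm⟩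
  induction hS with
  | trivial =>
    have : centralSub x hx (Rep.trivial k G k) = 0 := by
      ext
      exact sub_self (1 : k)
    rw [this]
    exact stablyTrivial_zero
  | omega n S hS hP h ih => exact (stablyTrivial_τ₁_iff_τ₃ hS hS (φ S)).2 ih
  | sigma n S hS hI h ih =>
    have := (projective_iff_injective S.X₂).2 hI
    exact (stablyTrivial_τ₁_iff_τ₃ hS hS (φ S)).1 ih

lemma isGhost_centralSub (M : Rep.{u} k G) : IsGhost (centralSub x hx M) :=
  (isGhost_iff _).2 fun n S hS a => by
    rw [centralSub_naturality]
    exact (stablyTrivial_centralSub x hx hS).comp a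

end Central

/-! ### Consequences of `G` being a `p`-group. -/

section Thick

variable {k G : Type u} [Field k] [Group G] {p : ℕ} [Fact p.Prime] [CharP k p]

/-- As `k` may be infinite, fixed points are counted modulo `p` in the finite `ZMod p`-span of one
orbit. -/
lemma exists_ne_zero_fixed (hG : IsPGroup p G) [Finite G] (M : Rep.{u} k G) [Nontrivial M.V] :
    ∃ v : M.V, v ≠ 0 ∧ ∀ g, M.ρ g v = v := by
  obtain ⟨w, hw⟩ := exists_ne (0 : M.V)
  let _ := ZMod.algebra k p
  let _ : Module (ZMod p) M.V := Module.compHom M.V (algebraMap (ZMod p) k)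
  let A : Submodule (ZMod p) M.V := Submodule.span (ZMod p) (Set.range fun g => M.ρ g w)
  have hA : ∀ (g : G) (a : M.V), a ∈ A → M.ρ g a ∈ A := by
    intro g a ha
    induction ha using Submodule.span_induction with
    | mem y hy =>
      obtain ⟨h, rfl⟩ := hy
      exact Submodule.subset_span ⟨g * h, by simp⟩
    | zero => simp
    | add y z _ _ hy hz => simpa using A.add_mem hy hz
    | smul c y _ hy =>
      have : M.ρ g (c • y) = c • M.ρ g y := map_smul (M.ρ g) (algebraMap (ZMod p) k c) y
      rw [this]
      exact A.smul_mem c hy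
  have hwA : w ∈ A := Submodule.subset_span ⟨1, by simp⟩
  have : Module.Finite (ZMod p) A := Module.Finite.span_of_finite _ (Set.finite_range _)
  have : Finite A := Module.finite_of_finite (ZMod p)
  let _ : MulAction G A :=
    { smul := fun g a => ⟨M.ρ g a, hA g a a.2⟩
      one_smul := fun a => Subtype.ext (by change M.ρ 1 a = a; simp)
      mul_smul := fun g h a => Subtype.ext (by change M.ρ (g * h) a = M.ρ g (M.ρ h a); simp) }
  have : Nontrivial A := ⟨⟨w, hwA⟩, 0, fun h => hw (congrArg Subtype.val h)⟩
  have hcard : p ∣ Nat.card A := by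
    rw [Module.natCard_eq_pow_finrank (K := ZMod p), Nat.card_zmod]
    exact dvd_pow_self p Module.finrank_pos.ne'
  have h0 : (0 : A) ∈ MulAction.fixedPoints G A := fun g => Subtype.ext (map_zero (M.ρ g))
  obtain ⟨b, hb, hb0⟩ := hG.exists_fixed_point_of_prime_dvd_card_of_fixed_point A hcard h0
  exact ⟨b, fun h => hb0 (Subtype.ext h.symm), fun g => congrArg Subtype.val (hb g)⟩

lemma inThick_of_finite (hG : IsPGroup p G) [Finite G] (M : Rep.{u} k G) [Module.Finite k M.V] :
    InThick M := by
  induction h : Module.finrank k M.V using Nat.strong_induction_on generalizing M with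
  | h n ih =>
    rcases subsingleton_or_nontrivial M.V with hM | hM
    · refine .retract M _ ⟨0, 0, ?_⟩ .trivial
      have : 𝟙 M = 0 := by
        ext m
        exact Subsingleton.elim _ _
      rw [this, comp_zero]
      exact StablyEq.refl _
    · obtain ⟨v, hv, hvG⟩ := exists_ne_zero_fixed hG M
      let f : Rep.trivial k G k ⟶ M := Rep.ofHom (ρ := (Rep.trivial k G k).ρ) (σ := M.ρ)
        ⟨LinearMap.toSpanSingleton k M.V v, fun g => by ext; simp [hvG]⟩
      have hf : f.hom (1 : k) = v := one_smul k v
      have : Mono f := (Rep.mono_iff_injective f).2 (smul_left_injective k hv)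
      let q : M.V →ₗ[k] (cokernel f).V := (cokernel.π f).hom.toLinearMap
      have hq : Function.Surjective q := (Rep.epi_iff_surjective (cokernel.π f)).1 inferInstance
      have : Module.Finite k (cokernel f).V := Module.Finite.of_surjective q hq
      have hvq : v ∈ LinearMap.ker q := by
        have := congrArg (fun e => e.hom (1 : k)) (cokernel.condition f)
        rw [← hf]
        exact this
      have : Nontrivial (LinearMap.ker q) := ⟨⟨v, hvq⟩, 0, fun e => hv (congrArg Subtype.val e)⟩
      have hpos : 0 < Module.finrank k (LinearMap.ker q) := Module.finrank_pos
      have hadd := q.finrank_range_add_finrank_ker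
      rw [LinearMap.range_eq_top.2 hq, finrank_top] at hadd
      exact .middle (ShortComplex.mk f (cokernel.π f) (by simp))
        { exact := ShortComplex.exact_cokernel f } .trivial
        (ih (Module.finrank k (cokernel f).V) (by omega) (cokernel f) rfl)

/-- An average on `k` is multiplication by a multiple of the order of `G`, which is zero in `k`. -/
lemma not_projective_trivial (hG : IsPGroup p G) [Finite G] [Nontrivial G] :
    ¬ Projective (Rep.trivial k G k) := by
  intro h
  have := Fintype.ofFinite G
  obtain ⟨θ, hθ⟩ := exists_average_of_projective (Rep.trivial k G k)
  have h₁ := average_trivial_apply_one (N := Rep.trivial k G k) θ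
  rw [hθ] at h₁
  obtain ⟨n, hn, hcard⟩ := hG.nontrivial_iff_card.1 inferInstance
  have h₂ : (Nat.card G : k) = 0 := by
    rw [hcard, Nat.cast_pow, CharP.cast_eq_zero, zero_pow hn.ne']
  have h₃ : (Rep.trivial k G k).ρ.norm (θ (1 : k)) = (Nat.card G : k) * (θ (1 : k) : k) := by
    simp [Representation.norm, Nat.card_eq_fintype_card]
  rw [h₃, h₂, zero_mul] at h₁
  exact one_ne_zero (α := k) h₁

end Thick

/-! ### Exact functors that preserve projectives. -/

section Functor

variable {k G H : Type u} [Field k] [Group G] [Group H]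
  (F : Rep.{u} k H ⥤ Rep.{u} k G) [F.Additive] [F.PreservesProjectiveObjects]

omit [F.Additive] in
lemma StablyTrivial.map {M N : Rep.{u} k H} {f : M ⟶ N} (hf : StablyTrivial f) :
    StablyTrivial (F.map f) := by
  obtain ⟨P, a, b, hP, rfl⟩ := hf
  exact ⟨F.obj P, F.map a, F.map b, F.projective_obj_of_projective hP, by simp⟩

lemma StablyEq.map {M N : Rep.{u} k H} {f g : M ⟶ N} (h : StablyEq f g) :
    StablyEq (F.map f) (F.map g) := by
  rw [StablyEq, ← F.map_sub]
  exact StablyTrivial.map F h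

lemma StableRetract.map {M N : Rep.{u} k H} (h : StableRetract M N) :
    StableRetract (F.obj M) (F.obj N) := by
  obtain ⟨i, r, hir⟩ := h
  exact ⟨F.map i, F.map r, by simpa using hir.map F⟩

lemma InThick.map [PreservesFiniteLimits F] [PreservesFiniteColimits F]
    {M : Rep.{u} k H} (hM : InThick M) (htriv : InThick (F.obj (Rep.trivial k H k))) :
    InThick (F.obj M) := by
  induction hM with
  | trivial => exact htriv
  | retract M N h hN ih => exact .retract _ _ (h.map F) ih
  | left S hS h₂ h₃ ih₂ ih₃ => exact .left (S.map F) (hS.map_of_exact F) ih₂ ih₃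
  | middle S hS h₁ h₃ ih₁ ih₃ => exact .middle (S.map F) (hS.map_of_exact F) ih₁ ih₃
  | right S hS h₁ h₂ ih₁ ih₂ => exact .right (S.map F) (hS.map_of_exact F) ih₁ ih₂

end Functor

/-! ### Induction as a two-sided adjoint of restriction. -/

section Induction

variable {k G : Type u} [Field k] [Group G] (H : Subgroup G)

/-- Induction from `H` to `G`. -/
abbrev induction : Rep.{u} k H ⥤ Rep.{u} k G := Rep.indFunctor k H.subtype

/-- Restriction from `G` to `H`. -/
abbrev restriction : Rep.{u} k G ⥤ Rep.{u} k H := Rep.resFunctor H.subtype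

/-- Induction is left adjoint to restriction. -/
abbrev indAdj : induction (k := k) H ⊣ restriction H := Rep.indResAdjunction.{u, u, u} k H.subtype

instance : (induction (k := k) H).Additive := (indAdj H).left_adjoint_additive

instance : (induction (k := k) H).PreservesProjectiveObjects :=
  Functor.preservesProjectiveObjects_of_adjunction_of_preservesEpimorphisms (indAdj H)

variable [Fintype G]

open scoped Classical in
/-- Induction is right adjoint to restriction. -/
abbrev coindAdj : restriction (k := k) H ⊣ induction H := Rep.resIndAdjunction.{u, u, u} k H

lemma IsOmega.restrict {n : ℤ} {S : Rep.{u} k G} (hS : IsOmega n S) :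
    IsOmega n ((restriction H).obj S) := by
  have := Fintype.ofFinite H
  induction hS with
  | trivial => exact .trivial
  | omega n S hS hP h ih =>
    exact .omega n (S.map (restriction H)) (hS.map_of_exact _)
      ((restriction H).projective_obj_of_projective hP) ih
  | sigma n S hS hI h ih =>
    exact .sigma n (S.map (restriction H)) (hS.map_of_exact _)
      ((projective_iff_injective _).1 ((restriction H).projective_obj_of_projective
        ((projective_iff_injective _).2 hI))) ih

lemma IsGhost.induce [Fintype H] {M N : Rep.{u} k H} {f : M ⟶ N} (hf : IsGhost f) :
    IsGhost ((induction H).map f) := by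
  rw [isGhost_iff] at hf ⊢
  intro n S hS a
  obtain ⟨b, rfl⟩ := ((coindAdj H).homEquiv _ _).surjective a
  rw [← Adjunction.homEquiv_naturality_right, Adjunction.homEquiv_unit]
  exact ((hf n _ (hS.restrict H) b).map _).precomp _

omit [Fintype G] in
lemma indAdj_unit_apply (M : Rep.{u} k H) (m : M.V) :
    ((indAdj H).unit.app M).hom m = Representation.IndV.mk H.subtype M.ρ 1 m := by
  rfl

open scoped Classical in
lemma coindAdj_counit_mk (M : Rep.{u} k H) (g : G) (m : M.V) :
    ((coindAdj H).counit.app M).hom (Representation.IndV.mk H.subtype M.ρ g m) =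
      Rep.indToCoindAux M g m 1 := by
  rw [Rep.resIndAdjunction_counit_app]
  change (Rep.indToCoind M (Representation.IndV.mk H.subtype M.ρ g m)).1 1 = _
  simp only [Representation.IndV.mk, LinearMap.comp_apply, TensorProduct.mk_apply]
  simp
  rfl

lemma coindAdj_counit_ρ_unit_of_not_mem (M : Rep.{u} k H) (g : G) (hg : g ∉ H) (m : M.V) :
    ((coindAdj H).counit.app M).hom
      (((induction H).obj M).ρ g (((indAdj H).unit.app M).hom m)) = 0 := by
  classical
  rw [indAdj_unit_apply]
  refine (congrArg _ (Representation.ind_mk H.subtype M.ρ g 1 m)).trans ?_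
  rw [coindAdj_counit_mk]
  apply Rep.indToCoindAux_of_not_rel
  rintro ⟨h, hh⟩
  apply hg
  have : (h : G) * (1 * g⁻¹) = 1 := hh
  rw [one_mul, mul_inv_eq_one] at this
  exact this ▸ h.2

lemma indAdj_unit_coindAdj_counit (M : Rep.{u} k H) :
    (indAdj H).unit.app M ≫ (coindAdj H).counit.app M = 𝟙 M := by
  classical
  ext m
  refine (coindAdj_counit_mk H M 1 m).trans ?_
  rw [Rep.indToCoindAux_self]
  rfl

variable {x : G} (hx : x ∈ Subgroup.center G)

/-- Expanding `(x - 1)^c x^i` gives only powers of `x` with exponents from `i` to `i + c`, all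
outside `H`; the counit kills those cosets. -/
lemma counit_centralSubPow_ρ_pow_unit {l : ℕ} (hl : ∀ j, 0 < j → j < l → x ^ j ∉ H)
    (M : Rep.{u} k H) (m : M.V) (c i : ℕ) (hi : 0 < i) (hic : i + c < l) :
    ((coindAdj H).counit.app M).hom ((centralSubPow x hx ((induction H).obj M) c).hom
      (((induction H).obj M).ρ (x ^ i) (((indAdj H).unit.app M).hom m))) = 0 := by
  induction c generalizing i with
  | zero => exact coindAdj_counit_ρ_unit_of_not_mem H M _ (hl i hi hic) m
  | succ c ih =>
    rw [centralSubPow_succ, Rep.comp_apply]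
    erw [centralSub_apply]
    rw [map_sub, map_sub, ih i hi (by omega), ← Module.End.mul_apply, ← map_mul, ← pow_succ',
      ih (i + 1) (by omega) (by omega), sub_zero]

lemma counit_centralSubPow_unit {l : ℕ} (hl : ∀ j, 0 < j → j < l → x ^ j ∉ H)
    (M : Rep.{u} k H) (m : M.V) (c : ℕ) (hc : c < l) :
    ((coindAdj H).counit.app M).hom ((centralSubPow x hx ((induction H).obj M) c).hom
      (((indAdj H).unit.app M).hom m)) = (-1 : k) ^ c • m := by
  induction c with
  | zero =>
    rw [pow_zero, one_smul]
    exact ConcreteCategory.congr_hom (indAdj_unit_coindAdj_counit H M) m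
  | succ c ih =>
    rw [centralSubPow_succ, Rep.comp_apply]
    erw [centralSub_apply]
    have h := counit_centralSubPow_ρ_pow_unit H hx hl M m c 1 one_pos (by omega)
    rw [pow_one] at h
    rw [map_sub, map_sub, h, ih (by omega), zero_sub, pow_succ, mul_neg_one, neg_smul]

lemma stablyTrivial_of_centralSubPow_comp {l : ℕ} (hl : ∀ j, 0 < j → j < l → x ^ j ∉ H)
    {M N : Rep.{u} k H} (f : M ⟶ N) (c : ℕ) (hc : c < l)
    (h : StablyTrivial (centralSubPow x hx ((induction H).obj M) c ≫ (induction H).map f)) :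
    StablyTrivial f := by
  have h₁ := ((h.map (restriction H)).precomp ((indAdj H).unit.app M)).comp
    ((coindAdj H).counit.app N)
  have h₂ : ((indAdj H).unit.app M ≫ (restriction H).map
      (centralSubPow x hx ((induction H).obj M) c ≫ (induction H).map f)) ≫
        (coindAdj H).counit.app N = (-1 : k) ^ c • f := by
    rw [Functor.map_comp, Category.assoc, Category.assoc]
    have := (coindAdj H).counit.naturality f
    simp only [Functor.comp_map, Functor.id_map] at this
    rw [this]
    ext m
    refine (congrArg f.hom (counit_centralSubPow_unit H hx hl M m c hc)).trans ?_
    rw [map_smul]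
    rfl
  rw [h₂] at h₁
  rcases neg_one_pow_eq_or k c with h₃ | h₃
  · simpa [h₃] using h₁
  · rw [h₃, neg_one_smul, stablyTrivial_neg_iff] at h₁
    exact h₁

end Induction

/-! ### Composites of ghosts under induction. -/

section Powers

variable {k G : Type u} [Field k] [Group G] [Fintype G]

lemma InGt.left {n : ℕ} {M N : Rep.{u} k G} {f : M ⟶ N} (hf : InGt n f) : InThick M := by
  induction n generalizing N with
  | zero => exact hf.1
  | succ n ih =>
    obtain ⟨-, Y, g, h, hg, -, -⟩ := hf
    exact ih hg

lemma InGt.comp {m n : ℕ} {M N L : Rep.{u} k G} {f : M ⟶ N} {g : N ⟶ L} (hf : InGt m f)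
    (hg : InGt n g) : InGt (m + n) (f ≫ g) := by
  induction n generalizing L with
  | zero =>
    cases m with
    | zero => exact ⟨hf.1, hg.2⟩
    | succ m =>
      obtain ⟨-, Y, a, b, ha, hb, hab⟩ := hf
      -- With no ghost in `g`, it is absorbed into the last ghost of `f`.
      exact ⟨hg.2, Y, a, b ≫ g, ha, hb.comp g, by simpa using hab.comp g⟩
  | succ n ih =>
    obtain ⟨hL, Y, a, b, ha, hb, hab⟩ := hg
    exact ⟨hL, Y, f ≫ a, b, ih ha, hb, by simpa using hab.precomp f⟩

lemma inGt_centralSubPow {x : G} (hx : x ∈ Subgroup.center G) {M : Rep.{u} k G} (hM : InThick M)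
    (n : ℕ) : InGt n (centralSubPow x hx M n) := by
  induction n with
  | zero => exact ⟨hM, hM⟩
  | succ n ih => exact ⟨hM, M, _, _, ih, isGhost_centralSub x hx M, StablyEq.refl _⟩

lemma InGt.induce (H : Subgroup G) [Fintype H] (hH : InThick ((induction H).obj (Rep.trivial k H k)))
    {n : ℕ} {M N : Rep.{u} k H} {f : M ⟶ N} (hf : InGt n f) : InGt n ((induction H).map f) := by
  induction n generalizing N with
  | zero => exact ⟨hf.1.map _ hH, hf.2.map _ hH⟩
  | succ n ih =>
    obtain ⟨hN, Y, g, h, hg, hh, hgh⟩ := hf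
    exact ⟨hN.map _ hH, _, _, _, ih hg, hh.induce H,
      (induction H).map_comp g h ▸ hgh.map (induction H)⟩

lemma IsGhostComposite.induce (H : Subgroup G) [Fintype H] {n : ℕ} {M N : Rep.{u} k H} {f : M ⟶ N}
    (hf : IsGhostComposite n f) : IsGhostComposite n ((induction H).map f) := by
  induction n generalizing M with
  | zero => trivial
  | succ n ih =>
    obtain ⟨Y, g, h, hg, hh, rfl⟩ := hf
    exact ⟨_, _, _, hg.induce H, ih hh, ((induction H).map_comp g h).symm⟩

lemma IsGhostComposite.centralSubPow_comp {x : G} (hx : x ∈ Subgroup.center G) {n : ℕ}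
    {M N : Rep.{u} k G} {f : M ⟶ N} (hf : IsGhostComposite n f) (c : ℕ) :
    IsGhostComposite (c + n) (centralSubPow x hx M c ≫ f) := by
  induction c with
  | zero => simpa [centralSubPow] using hf
  | succ c ih =>
    rw [add_right_comm, centralSubPow_succ, Category.assoc]
    exact ⟨_, _, _, isGhost_centralSub x hx M, ih, rfl⟩

end Powers

/-! ### Comparing lengths and their suprema. -/

lemma sInf_natCast_add_le {A B : Set ℕ} {c : ℕ} (hB : ∀ n, n ∈ B → n + 1 ∈ B)
    (hAB : ∀ n, c + n ∈ B → n ∈ A) (hA : 1 ≤ sInf ((fun n : ℕ => (n : ℕ∞)) '' A)) :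
    sInf ((fun n : ℕ => (n : ℕ∞)) '' A) + (c : ℕ∞) ≤ sInf ((fun n : ℕ => (n : ℕ∞)) '' B) := by
  refine le_sInf ?_
  rintro _ ⟨j, hj, rfl⟩
  obtain hjc | hjc := lt_or_ge j c
  -- A bound below `c` would put `0` in `A`; this is where positive length is needed.
  · have hc : c ∈ B := Nat.le_induction (P := fun n _ => n ∈ B) hj (fun n _ => hB n) c hjc.le
    have h := hA.trans (sInf_le ⟨0, hAB 0 hc, rfl⟩)
    simp at h
  · obtain ⟨n, rfl⟩ := Nat.exists_eq_add_of_le hjc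
    have h : sInf ((fun n : ℕ => (n : ℕ∞)) '' A) ≤ n := sInf_le ⟨n, hAB n hj, rfl⟩
    calc _ ≤ (n : ℕ∞) + c := by gcongr
      _ = ((c + n : ℕ) : ℕ∞) := by rw [add_comm]; push_cast; rfl

section Lengths

variable {k G : Type u} [Field k] [Group G] [Fintype G] (H : Subgroup G) [Fintype H]

lemma gel_add_le_gel_ind {x : G} (hx : x ∈ Subgroup.center G) {l : ℕ}
    (hl : ∀ j, 0 < j → j < l → x ^ j ∉ H) (hl₀ : 0 < l)
    (M : Rep.{u} k H) (hM : 1 ≤ gel M) :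
    gel M + ((l - 1 : ℕ) : ℕ∞) ≤ gel (Rep.ind H.subtype M) := by
  refine sInf_natCast_add_le (fun n hn => InFn.succ hn) (fun n hn => ?_) hM
  refine (inFn_iff n M).2 fun N f hf => ?_
  exact stablyTrivial_of_centralSubPow_comp H hx hl f (l - 1) (by omega)
    ((inFn_iff _ _).1 hn _ _ ((hf.induce H).centralSubPow_comp hx (l - 1)))

lemma gl_add_le_gl_ind {x : G} (hx : x ∈ Subgroup.center G) {l : ℕ}
    (hl : ∀ j, 0 < j → j < l → x ^ j ∉ H) (hl₀ : 0 < l)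
    (hH : InThick ((induction H).obj (Rep.trivial k H k))) (M : Rep.{u} k H) (hM : 1 ≤ gl M) :
    gl M + ((l - 1 : ℕ) : ℕ∞) ≤ gl (Rep.ind H.subtype M) := by
  refine sInf_natCast_add_le (fun n hn N f hf => ?_) (fun n hn N f hf => ?_) hM
  · obtain ⟨-, Y, g, h, hg, -, hgh⟩ := hf
    exact hgh.stablyTrivial_iff.2 ((hn _ g hg).comp h)
  · exact stablyTrivial_of_centralSubPow_comp H hx hl f (l - 1) (by omega)
      (hn _ _ ((inGt_centralSubPow hx (hf.left.map _ hH) (l - 1)).comp (hf.induce H hH)))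

lemma one_le_sInf_natCast {A : Set ℕ} (hA : 0 ∉ A) :
    1 ≤ sInf ((fun n : ℕ => (n : ℕ∞)) '' A) := by
  refine le_sInf ?_
  rintro _ ⟨n, hn, rfl⟩
  exact Nat.one_le_cast.2 (Nat.one_le_iff_ne_zero.2 fun h => hA (h ▸ hn))

omit [Fintype G] in
lemma one_le_gel_trivial (h : ¬ Projective (Rep.trivial k G k)) : 1 ≤ gel (Rep.trivial k G k) :=
  one_le_sInf_natCast h

lemma one_le_gl_trivial (h : ¬ Projective (Rep.trivial k G k)) : 1 ≤ gl (Rep.trivial k G k) :=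
  one_le_sInf_natCast fun h₀ => h (projective_of_stablyTrivial_id (h₀ _ (𝟙 _) ⟨.trivial, .trivial⟩))

end Lengths

lemma iSup_add_le_iSup {α β : Type*} (f : α → ℕ∞) (g : β → ℕ∞) (F : α → β) (c : ℕ∞)
    (h : ∀ a, 1 ≤ f a → f a + c ≤ g (F a)) (a₀ : α) (h₀ : 1 ≤ f a₀) :
    (⨆ a, f a) + c ≤ ⨆ b, g b := by
  have : Nonempty α := ⟨a₀⟩
  rw [ENat.iSup_add]
  refine iSup_le fun a => ?_
  by_cases ha : 1 ≤ f a
  · exact (h a ha).trans (le_iSup g _)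
  -- Terms of value `0` are dominated by the term at `a₀`.
  · rw [Order.one_le_iff_ne_zero, not_not] at ha
    calc f a + c ≤ f a₀ + c := by rw [ha]; gcongr; exact zero_le
      _ ≤ _ := (h a₀ h₀).trans (le_iSup g _)

end StableRep

end

theorem mainTheorem6 {k G : Type u} [Field k] [Group G] [Fintype G]
    (p : ℕ) [Fact p.Prime] [CharP k p] (hG : IsPGroup p G)
    (H : Subgroup G) [Fintype H] (hH : H ≠ ⊥)
    (x : G) (hx : x ∈ Subgroup.center G)
    (l : ℕ) (hl : IsLeast {j : ℕ | 0 < j ∧ x ^ j ∈ H} l) :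
    (∀ M : Rep.{u} k H, 1 ≤ StableRep.gel M →
      StableRep.gel M + ((l - 1 : ℕ) : ℕ∞) ≤ StableRep.gel (Rep.ind H.subtype M)) ∧
    StableRep.generatingNumber k H + ((l - 1 : ℕ) : ℕ∞) ≤ StableRep.generatingNumber k G ∧
    (∀ M : Rep.{u} k H, StableRep.InStmod M → 1 ≤ StableRep.gl M →
      StableRep.gl M + ((l - 1 : ℕ) : ℕ∞) ≤ StableRep.gl (Rep.ind H.subtype M)) ∧
    StableRep.ghostNumber k H + ((l - 1 : ℕ) : ℕ∞) ≤ StableRep.ghostNumber k G := by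
  have hl₀ : 0 < l := hl.1.1
  have hlt : ∀ j, 0 < j → j < l → x ^ j ∉ H := fun j hj hjl hxj =>
    absurd (hl.2 ⟨hj, hxj⟩) (not_le.2 hjl)
  have hthick : StableRep.InThick ((StableRep.induction H).obj (Rep.trivial k H k)) := by
    have : Module.Finite k ((StableRep.induction H).obj (Rep.trivial k H k)).V :=
      inferInstanceAs (Module.Finite k (Representation.IndV H.subtype (Rep.trivial k H k).ρ))
    exact StableRep.inThick_of_finite hG _
  have : Nontrivial H := (Subgroup.nontrivial_iff_ne_bot H).2 hH
  have hproj : ¬ Projective (Rep.trivial k H k) :=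
    StableRep.not_projective_trivial (hG.to_subgroup H)
  have hgel := StableRep.gel_add_le_gel_ind (k := k) H hx hlt hl₀
  have hgl := StableRep.gl_add_le_gl_ind H hx hlt hl₀ hthick
  refine ⟨hgel, ?_, fun M _ => hgl M, ?_⟩
  · exact StableRep.iSup_add_le_iSup _ _ (fun M => ⟨_, M.2.map (StableRep.induction H) hthick⟩) _
      (fun M => hgel M.1) ⟨_, .trivial⟩ (StableRep.one_le_gel_trivial hproj)
  · exact StableRep.iSup_add_le_iSup _ _ (fun M => ⟨_, M.2.map (StableRep.induction H) hthick⟩) _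
      (fun M => hgl M.1) ⟨_, .trivial⟩ (StableRep.one_le_gl_trivial hproj)
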